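/- For integers $n>k\ge 1$ let $\mathrm{Gr}_k(\mathbb R^n)$ be the Grassmannian of $k$-dimensional linear subspaces of $\mathbb R^n$ with its standard smooth structure, and let $\mathbb{RP}^m=\mathrm{Gr}_1(\mathbb R^{m+1})$; write $[u]$ for the line spanned by $u\in\mathbb R^{m+1}\setminus\{0\}$. Let $\mathbb H=\mathbb R^4$ be the quaternions, with pure quaternions identified with $\mathbb R^3$ by their coordinates in $i,j,k$. Let $\mathbb O=\mathbb R^8$ be the octonions with basis $e_0,\dots,e_7$ and the bilinear multiplication for which $e_0$ is the unit, $e_i^2=-e_0$ and $e_ie_j=-e_je_i$ for distinct $i,j\ge 1$, and $$e_1e_2=e_3,\quad e_1e_4=e_5,\quad e_1e_7=e_6,\quad e_2e_4=e_6,\quad e_2e_5=e_7,\quad e_3e_4=e_7,\quad e_3e_6=e_5,$$ together with the relations obtained from each $e_ae_b=e_c$ by cyclic permutation ($e_be_c=e_a$, $e_ce_a=e_b$); the conjugate of $x=\sum_i x_ie_i$ is $\bar x=x_0e_0-\sum_{i\ge 1}x_ie_i$, and pure octonions (those with $\bar x=-x$) are identified with $\mathbb R^7$ by their coordinates in $e_1,\dots,e_7$.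 In both algebras $\frac12(y\bar x-x\bar y)$ is pure for all $x,y$, and it is nonzero if $x,y$ are linearly independent; up to a nonzero factor it depends only on the plane $\langle x,y\rangle$ spanned by $x,y$. Hence the formula $$\langle x,y\rangle\longmapsto\left[\tfrac12\,(y\bar x-x\bar y)\right]$$ defines maps $\nu_4:\mathrm{Gr}_2(\mathbb R^4)\to\mathbb{RP}^2$ (quaternionic multiplication) and $\nu_8:\mathrm{Gr}_2(\mathbb R^8)\to\mathbb{RP}^6$ (octonionic multiplication). **Theorem.** The maps $\nu_4:\mathrm{Gr}_2(\mathbb R^4)\to\mathbb{RP}^2$ and $\nu_8:\mathrm{Gr}_2(\mathbb R^8)\to\mathbb{RP}^6$ are submersions, that is, they are smooth ($C^\infty$) and their differentials are surjective at every point. -/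

import Mathlib

open scoped Manifold ContDiff Quaternion Topology

noncomputable section

/-! ## Real Grassmannians as smooth manifolds -/

/-- The Grassmannian of `k`-dimensional linear subspaces of `ℝⁿ`. -/
def RealGrassmannian (k n : ℕ) : Type :=
  {W : Submodule ℝ (EuclideanSpace ℝ (Fin n)) // Module.finrank ℝ W = k}

namespace RealGrassmannian

variable {k n : ℕ}

/-- Ordered `k`-tuples of linearly independent vectors of `ℝⁿ`. -/
abbrev Frame (k n : ℕ) : Type :=
  {v : Fin k → EuclideanSpace ℝ (Fin n) // LinearIndependent ℝ v}

/-- The subspace spanned by a linearly independent tuple. -/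
def ofFrame (v : Frame k n) : RealGrassmannian k n :=
  ⟨Submodule.span ℝ (Set.range v.1), by simpa using finrank_span_eq_card v.2⟩

/-- The quotient topology from the space of linearly independent `k`-tuples. -/
instance : TopologicalSpace (RealGrassmannian k n) :=
  TopologicalSpace.coinduced ofFrame inferInstance

/-- The model space of `RealGrassmannian k n`: linear maps `ℝᵏ → ℝⁿ⁻ᵏ`. -/
abbrev Model (k n : ℕ) : Type :=
  EuclideanSpace ℝ (Fin k) →L[ℝ] EuclideanSpace ℝ (Fin (n - k))

/-- Linear splittings `ℝⁿ ≃ ℝᵏ × ℝⁿ⁻ᵏ`; they index the charts. -/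
abbrev Splitting (k n : ℕ) : Type :=
  EuclideanSpace ℝ (Fin n) ≃L[ℝ] EuclideanSpace ℝ (Fin k) × EuclideanSpace ℝ (Fin (n - k))

/-- The subspace which is the graph of `T : ℝᵏ → ℝⁿ⁻ᵏ` with respect to the splitting `φ`. -/
def ofGraph (φ : Splitting k n) (T : Model k n) : RealGrassmannian k n :=
  ⟨(T.toLinearMap.graph).comap φ.toLinearEquiv.toLinearMap, by
    have e1 : (T.toLinearMap.graph).comap φ.toLinearEquiv.toLinearMap
        = (T.toLinearMap.graph).map φ.symm.toLinearEquiv.toLinearMap := by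
      ext w
      simp only [Submodule.mem_comap, Submodule.mem_map]
      constructor
      · intro h
        exact ⟨_, h, by simp⟩
      · rintro ⟨y, hy, rfl⟩
        simpa using hy
    rw [e1, LinearEquiv.finrank_map_eq, LinearMap.graph_eq_range_prod,
      LinearMap.finrank_range_of_inj]
    · simp
    · intro x y h
      simpa using congrArg Prod.fst h⟩

theorem mem_ofGraph {φ : Splitting k n} {T : Model k n} {w : EuclideanSpace ℝ (Fin n)} :
    w ∈ (ofGraph φ T).1 ↔ (φ w).2 = T (φ w).1 := by
  simp [ofGraph, LinearMap.mem_graph_iff]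

theorem ofGraph_injective (φ : Splitting k n) : Function.Injective (ofGraph φ) := by
  intro T S h
  ext1 x
  have h1 : φ.symm (x, T x) ∈ (ofGraph φ T).1 := by simp [mem_ofGraph]
  rw [h] at h1
  simpa [mem_ofGraph] using h1

/-- The linear map `ℝᵏ → V` that sends the standard basis to the tuple `v`. -/
def colMap {V : Type} [NormedAddCommGroup V] [NormedSpace ℝ V] (v : Fin k → V) :
    EuclideanSpace ℝ (Fin k) →L[ℝ] V :=
  ∑ i, (EuclideanSpace.proj i : EuclideanSpace ℝ (Fin k) →L[ℝ] ℝ).smulRight (v i)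

theorem colMap_apply {V : Type} [NormedAddCommGroup V] [NormedSpace ℝ V] (v : Fin k → V)
    (x : EuclideanSpace ℝ (Fin k)) : colMap v x = ∑ i, x i • v i := by
  simp [colMap]

theorem continuous_colMap {V : Type} [NormedAddCommGroup V] [NormedSpace ℝ V] :
    Continuous (colMap : (Fin k → V) → _) := by
  unfold colMap
  refine continuous_finsetSum _ fun i _ => ?_
  exact (ContinuousLinearMap.smulRightL ℝ (EuclideanSpace ℝ (Fin k)) V
    (EuclideanSpace.proj i)).continuous.comp (continuous_apply i)

/-- If a `k`-dimensional subspace is the range of `C : ℝᵏ → ℝⁿ`, it is a graph over the splitting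
`φ` exactly when the first component of `φ ∘ C` is invertible. -/
theorem eq_ofGraph_iff (φ : Splitting k n) (W : RealGrassmannian k n)
    (C : EuclideanSpace ℝ (Fin k) →L[ℝ] EuclideanSpace ℝ (Fin n))
    (hC : LinearMap.range C.toLinearMap = W.1) (T : Model k n) :
    ofGraph φ T = W ↔
      IsUnit ((ContinuousLinearMap.fst ℝ _ _).comp (φ.toContinuousLinearMap.comp C)) ∧
      ((ContinuousLinearMap.snd ℝ _ _).comp (φ.toContinuousLinearMap.comp C)).comp
        (Ring.inverse
          ((ContinuousLinearMap.fst ℝ _ _).comp (φ.toContinuousLinearMap.comp C))) = T := by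
  have hCinj : Function.Injective C := by
    have h1 : Module.finrank ℝ (LinearMap.range C.toLinearMap) = k := by rw [hC]; exact W.2
    have h2 := LinearMap.finrank_range_add_finrank_ker C.toLinearMap
    rw [h1] at h2
    simp only [finrank_euclideanSpace, Fintype.card_fin] at h2
    have h3 : LinearMap.ker C.toLinearMap = ⊥ := by
      apply Submodule.finrank_eq_zero.mp
      omega
    exact LinearMap.ker_eq_bot.mp h3
  set A := (ContinuousLinearMap.fst ℝ _ _).comp (φ.toContinuousLinearMap.comp C) with hA
  set B := (ContinuousLinearMap.snd ℝ _ _).comp (φ.toContinuousLinearMap.comp C) with hB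
  have hAx : ∀ x, A x = (φ (C x)).1 := fun x => rfl
  have hBx : ∀ x, B x = (φ (C x)).2 := fun x => rfl
  have key : ofGraph φ T = W ↔ ∀ x, B x = T (A x) := by
    constructor
    · intro h x
      have : C x ∈ W.1 := by rw [← hC]; exact ⟨x, rfl⟩
      rw [← h, mem_ofGraph] at this
      exact this
    · intro h
      have hle : W.1 ≤ (ofGraph φ T).1 := by
        rw [← hC]
        rintro _ ⟨x, rfl⟩
        exact mem_ofGraph.2 (h x)
      exact (Subtype.ext (Submodule.eq_of_le_of_finrank_eq hle (by rw [W.2, (ofGraph φ T).2]))).symm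
  rw [key]
  constructor
  · intro h
    have hAinj : Function.Injective A := by
      intro x y hxy
      apply hCinj
      apply φ.injective
      apply Prod.ext
      · exact hxy
      · rw [← hBx, ← hBx, h, h, hxy]
    have hu : IsUnit A := by
      let e : EuclideanSpace ℝ (Fin k) ≃L[ℝ] EuclideanSpace ℝ (Fin k) :=
        (LinearEquiv.ofInjectiveEndo A.toLinearMap hAinj).toContinuousLinearEquiv
      have he : (e : EuclideanSpace ℝ (Fin k) →L[ℝ] EuclideanSpace ℝ (Fin k)) = A := by
        ext1 x
        rfl
      rw [← he]
      exact ⟨ContinuousLinearEquiv.toUnit e, rfl⟩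
    refine ⟨hu, ?_⟩
    have hBT : B = T.comp A := by ext1 x; exact h x
    rw [hBT, ContinuousLinearMap.comp_assoc]
    have := Ring.mul_inverse_cancel A hu
    change A.comp (Ring.inverse A) = ContinuousLinearMap.id ℝ _ at this
    rw [this, ContinuousLinearMap.comp_id]
  · rintro ⟨hu, rfl⟩ x
    have := Ring.inverse_mul_cancel A hu
    have h2 := congrArg (fun L => L x) this
    change Ring.inverse A (A x) = x at h2
    simp only [ContinuousLinearMap.comp_apply, h2]

theorem range_colMap (v : Fin k → EuclideanSpace ℝ (Fin n)) :
    LinearMap.range (colMap v).toLinearMap = Submodule.span ℝ (Set.range v) := by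
  ext w
  rw [Submodule.mem_span_range_iff_exists_fun]
  constructor
  · rintro ⟨x, rfl⟩
    exact ⟨x, (colMap_apply v x).symm⟩
  · rintro ⟨c, rfl⟩
    exact ⟨WithLp.toLp 2 c, by simp [colMap_apply]⟩

/-- The tuple `φ⁻¹(eᵢ, T eᵢ)` spanning the graph of `T`. -/
theorem exists_frame_ofGraph (φ : Splitting k n) : ∃ f : Model k n → Frame k n,
    Continuous f ∧ ∀ T, ofFrame (f T) = ofGraph φ T := by
  let g : Model k n → Fin k → EuclideanSpace ℝ (Fin n) := fun T i =>
    φ.symm (EuclideanSpace.single i 1, T (EuclideanSpace.single i 1))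
  have hg : Continuous g := by
    refine continuous_pi fun i => ?_
    exact φ.symm.continuous.comp (continuous_const.prodMk
      ((ContinuousLinearMap.apply ℝ _ (EuclideanSpace.single i (1 : ℝ))).continuous))
  have hli : ∀ T, LinearIndependent ℝ (g T) := by
    intro T
    have h0 : LinearIndependent ℝ
        (fun i : Fin k => (EuclideanSpace.single i (1 : ℝ) : EuclideanSpace ℝ (Fin k))) := by
      have h1 : (fun i : Fin k =>
          (EuclideanSpace.single i (1 : ℝ) : EuclideanSpace ℝ (Fin k))) =
          (EuclideanSpace.basisFun (Fin k) ℝ).toBasis := by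
        ext1 i
        simp
      rw [h1]
      exact (EuclideanSpace.basisFun (Fin k) ℝ).toBasis.linearIndependent
    refine LinearIndependent.of_comp
      ((LinearMap.fst ℝ _ _).comp φ.toLinearEquiv.toLinearMap) ?_
    convert h0 using 1
    ext1 i
    simp [g]
  refine ⟨fun T => ⟨g T, hli T⟩, hg.subtype_mk _, fun T => ?_⟩
  apply Subtype.ext
  apply Submodule.eq_of_le_of_finrank_eq
  · change Submodule.span ℝ (Set.range (g T)) ≤ _
    rw [Submodule.span_le]
    rintro _ ⟨i, rfl⟩
    exact mem_ofGraph.2 (by simp [g])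
  · rw [(ofGraph φ T).2, (ofFrame _).2]

theorem isOpenEmbedding_ofGraph (φ : Splitting k n) :
    Topology.IsOpenEmbedding (ofGraph φ) := by
  refine Topology.IsOpenEmbedding.of_continuous_injective_isOpenMap ?_ (ofGraph_injective φ) ?_
  · obtain ⟨f, hf, h⟩ := exists_frame_ofGraph φ
    have : ofGraph φ = ofFrame ∘ f := by ext1 T; exact (h T).symm
    rw [this]
    exact continuous_coinduced_rng.comp hf
  · intro U hU
    rw [isOpen_coinduced]
    let A : Frame k n → (EuclideanSpace ℝ (Fin k) →L[ℝ] EuclideanSpace ℝ (Fin k)) := fun v =>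
      (ContinuousLinearMap.fst ℝ _ _).comp (φ.toContinuousLinearMap.comp (colMap v.1))
    let B : Frame k n → Model k n := fun v =>
      (ContinuousLinearMap.snd ℝ _ _).comp (φ.toContinuousLinearMap.comp (colMap v.1))
    have hA : Continuous A := continuous_const.clm_comp
      (continuous_const.clm_comp (continuous_colMap.comp continuous_subtype_val))
    have hB : Continuous B := continuous_const.clm_comp
      (continuous_const.clm_comp (continuous_colMap.comp continuous_subtype_val))
    have hset : ofFrame ⁻¹' (ofGraph φ '' U) =
        {v | IsUnit (A v) ∧ (B v).comp (Ring.inverse (A v)) ∈ U} := by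
      ext v
      constructor
      · rintro ⟨T, hT, h⟩
        obtain ⟨h1, h2⟩ := (eq_ofGraph_iff φ (ofFrame v) (colMap v.1) (range_colMap _) T).1 h
        refine ⟨h1, ?_⟩
        change (B v).comp (Ring.inverse (A v)) = T at h2
        rw [h2]
        exact hT
      · rintro ⟨h1, h2⟩
        exact ⟨_, h2, (eq_ofGraph_iff φ (ofFrame v) (colMap v.1) (range_colMap _) _).2 ⟨h1, rfl⟩⟩
    rw [hset, isOpen_iff_mem_nhds]
    rintro v ⟨hu, hv⟩
    have h1 : ∀ᶠ w in 𝓝 v, IsUnit (A w) := hA.continuousAt.eventually (Units.isOpen.mem_nhds hu)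
    have hinv : ContinuousAt (fun w => Ring.inverse (A w)) v := by
      obtain ⟨u, hu'⟩ := hu
      have := NormedRing.inverse_continuousAt u
      rw [hu'] at this
      exact ContinuousAt.comp (f := A) this hA.continuousAt
    have h2 : ∀ᶠ w in 𝓝 v, (B w).comp (Ring.inverse (A w)) ∈ U :=
      (hB.continuousAt.clm_comp hinv).eventually (hU.mem_nhds hv)
    filter_upwards [h1, h2] with w hw1 hw2 using ⟨hw1, hw2⟩

/-- The chart attached to a splitting `φ` of `ℝⁿ`. It is defined on the subspaces that are graphs
over the first factor, and it sends such a subspace to the linear map of which it is the graph. -/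
def chart (φ : Splitting k n) : OpenPartialHomeomorph (RealGrassmannian k n) (Model k n) :=
  ((isOpenEmbedding_ofGraph φ).toOpenPartialHomeomorph (ofGraph φ)).symm

theorem exists_mem_chart_source (W : RealGrassmannian k n) :
    ∃ φ : Splitting k n, W ∈ (chart φ).source := by
  obtain ⟨W, hW⟩ := W
  obtain ⟨C, hC⟩ := Submodule.exists_isCompl W
  have hdim := Submodule.finrank_add_eq_of_isCompl hC
  simp only [finrank_euclideanSpace, Fintype.card_fin] at hdim
  let e1 : W ≃ₗ[ℝ] EuclideanSpace ℝ (Fin k) := LinearEquiv.ofFinrankEq _ _ (by simpa using hW)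
  let e2 : C ≃ₗ[ℝ] EuclideanSpace ℝ (Fin (n - k)) :=
    LinearEquiv.ofFinrankEq _ _ (by rw [finrank_euclideanSpace, Fintype.card_fin]; omega)
  let φ : Splitting k n :=
    ((Submodule.prodEquivOfIsCompl W C hC).symm.trans (e1.prodCongr e2)).toContinuousLinearEquiv
  refine ⟨φ, ?_⟩
  have : ofGraph φ 0 = ⟨W, hW⟩ := by
    apply Subtype.ext
    refine (Submodule.eq_of_le_of_finrank_eq ?_ ?_).symm
    · intro w hw
      rw [mem_ofGraph]
      change e2 ((Submodule.prodEquivOfIsCompl W C hC).symm w).2 = 0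
      rw [Submodule.prodEquivOfIsCompl_symm_apply_left W C hC ⟨w, hw⟩]
      simp
    · rw [(ofGraph φ 0).2]
      exact hW
  simp only [chart, OpenPartialHomeomorph.symm_source,
    Topology.IsOpenEmbedding.toOpenPartialHomeomorph_target]
  exact ⟨0, this⟩

/-- The standard atlas of the Grassmannian, given by all the splittings of `ℝⁿ`. -/
instance : ChartedSpace (Model k n) (RealGrassmannian k n) where
  atlas := Set.range chart
  chartAt W := chart (exists_mem_chart_source W).choose
  mem_chart_source W := (exists_mem_chart_source W).choose_spec
  chart_mem_atlas _ := ⟨_, rfl⟩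

instance : IsManifold 𝓘(ℝ, Model k n) ∞ (RealGrassmannian k n) := by
  apply isManifold_of_contDiffOn
  rintro _ _ ⟨φ, rfl⟩ ⟨ψ, rfl⟩
  simp only [modelWithCornersSelf_coe, modelWithCornersSelf_coe_symm, Function.comp_id,
    Function.id_comp, Set.preimage_id, Set.range_id, Set.inter_univ]
  let C : Model k n → (EuclideanSpace ℝ (Fin k) →L[ℝ] EuclideanSpace ℝ (Fin n)) := fun T =>
    φ.symm.toContinuousLinearMap.comp ((ContinuousLinearMap.id ℝ _).prod T)
  have hCr : ∀ T, LinearMap.range (C T).toLinearMap = (ofGraph φ T).1 := by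
    intro T
    ext w
    rw [mem_ofGraph]
    constructor
    · rintro ⟨x, rfl⟩
      simp [C]
    · intro h
      refine ⟨(φ w).1, ?_⟩
      change φ.symm ((φ w).1, T (φ w).1) = w
      rw [← h]
      simp
  let A : Model k n → (EuclideanSpace ℝ (Fin k) →L[ℝ] EuclideanSpace ℝ (Fin k)) := fun T =>
    (ContinuousLinearMap.fst ℝ _ _).comp (ψ.toContinuousLinearMap.comp (C T))
  let B : Model k n → Model k n := fun T =>
    (ContinuousLinearMap.snd ℝ _ _).comp (ψ.toContinuousLinearMap.comp (C T))
  have hC : ContDiff ℝ ∞ C := by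
    refine contDiff_const.clm_comp ?_
    have : (ContinuousLinearMap.id ℝ (EuclideanSpace ℝ (Fin k))).prod =
        fun T : Model k n => (ContinuousLinearMap.inl ℝ _ _) + (ContinuousLinearMap.inr ℝ _ _).comp T := by
      ext1 T
      ext1 x
      simp
    rw [this]
    exact contDiff_const.add (ContDiff.clm_comp (g := fun _ : Model k n =>
      ContinuousLinearMap.inr ℝ (EuclideanSpace ℝ (Fin k)) (EuclideanSpace ℝ (Fin (n - k))))
      contDiff_const contDiff_id)
  have hA : ContDiff ℝ ∞ A := contDiff_const.clm_comp (contDiff_const.clm_comp hC)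
  have hB : ContDiff ℝ ∞ B := contDiff_const.clm_comp (contDiff_const.clm_comp hC)
  intro T hT
  have hmem : ∀ S ∈ ((chart φ).symm.trans (chart ψ)).source, IsUnit (A S) ∧
      ((chart φ).symm.trans (chart ψ)) S = (B S).comp (Ring.inverse (A S)) := by
    intro S hS
    have hS' : ofGraph φ S ∈ (chart ψ).source := by
      rw [OpenPartialHomeomorph.trans_source] at hS
      exact hS.2
    have h1 : ofGraph ψ (chart ψ (ofGraph φ S)) = ofGraph φ S := (chart ψ).left_inv hS'
    obtain ⟨h2, h3⟩ := (eq_ofGraph_iff ψ _ (C S) (hCr S) _).1 h1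
    exact ⟨h2, h3.symm⟩
  have hinv : ContDiffAt ℝ ∞ (fun S => Ring.inverse (A S)) T := by
    obtain ⟨u, hu⟩ := (hmem T hT).1
    have := contDiffAt_ringInverse ℝ (n := ∞) u
    rw [hu] at this
    exact ContDiffAt.comp (f := A) T this hA.contDiffAt
  exact (hB.contDiffAt.clm_comp hinv).contDiffWithinAt.congr (fun S hS => (hmem S hS).2)
    (hmem T hT).2

end RealGrassmannian

/-- Real projective space `ℝPᵐ`: the lines through the origin of `ℝᵐ⁺¹`, with the smooth structure
of the Grassmannian of lines. -/
abbrev RealProjectiveSpace (m : ℕ) : Type := RealGrassmannian 1 (m + 1)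

/-- The class `[u]` of a nonzero vector `u`. -/
def RealProjectiveSpace.mk {m : ℕ} (u : EuclideanSpace ℝ (Fin (m + 1))) (hu : u ≠ 0) :
    RealProjectiveSpace m :=
  ⟨Submodule.span ℝ {u}, finrank_span_singleton hu⟩

theorem RealProjectiveSpace.mk_eq_mk_iff {m : ℕ} (u v : EuclideanSpace ℝ (Fin (m + 1)))
    (hu : u ≠ 0) (hv : v ≠ 0) : mk u hu = mk v hv ↔ ∃ c : ℝ, c ≠ 0 ∧ u = c • v := by
  refine Subtype.ext_iff.trans ?_
  change Submodule.span ℝ {u} = Submodule.span ℝ {v} ↔ _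
  rw [Submodule.span_singleton_eq_span_singleton]
  constructor
  · rintro ⟨c, hc⟩
    refine ⟨(c⁻¹ : ℝˣ), Units.ne_zero _, ?_⟩
    rw [← hc]
    exact (inv_smul_smul c u).symm
  · rintro ⟨c, hc, rfl⟩
    exact ⟨(Units.mk0 c hc)⁻¹, inv_smul_smul (Units.mk0 c hc) v⟩

theorem RealProjectiveSpace.exists_mk {m : ℕ} (L : RealProjectiveSpace m) :
    ∃ u hu, L = mk u hu := by
  obtain ⟨L, hL⟩ := L
  obtain ⟨u, hu, h⟩ := finrank_eq_one_iff'.1 hL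
  have hu' : (u : EuclideanSpace ℝ (Fin (m + 1))) ≠ 0 := by simpa using hu
  refine ⟨u, hu', Subtype.ext (Submodule.eq_of_le_of_finrank_eq ?_ ?_).symm⟩
  · exact (Submodule.span_singleton_le_iff_mem _ _).2 u.2
  · rw [hL, (mk _ hu').2]

/-- A smooth submersion between manifolds modelled on normed spaces: a smooth map whose
differential is surjective at every point. -/
def IsSmoothSubmersion (E F : Type*) [NormedAddCommGroup E] [NormedSpace ℝ E]
    [NormedAddCommGroup F] [NormedSpace ℝ F] {M N : Type*}
    [TopologicalSpace M] [ChartedSpace E M] [IsManifold 𝓘(ℝ, E) ∞ M]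
    [TopologicalSpace N] [ChartedSpace F N] [IsManifold 𝓘(ℝ, F) ∞ N] (f : M → N) : Prop :=
  ContMDiff 𝓘(ℝ, E) 𝓘(ℝ, F) ∞ f ∧ ∀ p : M, Function.Surjective (mfderiv 𝓘(ℝ, E) 𝓘(ℝ, F) f p)

/-! ## Maps from planes to lines -/

/-- The plane `⟨x, y⟩`. -/
def planeSpan {n : ℕ} (x y : EuclideanSpace ℝ (Fin n)) (h : LinearIndependent ℝ ![x, y]) :
    RealGrassmannian 2 n :=
  RealGrassmannian.ofFrame ⟨![x, y], h⟩

theorem span_alternating {n : ℕ} {V : Type*} [AddCommGroup V] [Module ℝ V]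
    (μ : EuclideanSpace ℝ (Fin n) →ₗ[ℝ] EuclideanSpace ℝ (Fin n) →ₗ[ℝ] V)
    (halt : ∀ x, μ x x = 0) (x y : EuclideanSpace ℝ (Fin n)) :
    Submodule.span ℝ {z | ∃ a ∈ Submodule.span ℝ {x, y}, ∃ b ∈ Submodule.span ℝ {x, y},
      μ a b = z} = Submodule.span ℝ {μ x y} := by
  have hneg : μ y x = - μ x y := by
    have h := halt (x + y)
    simp only [map_add, LinearMap.add_apply, halt, zero_add, add_zero] at h
    exact eq_neg_of_add_eq_zero_left h
  apply le_antisymm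
  · rw [Submodule.span_le]
    rintro _ ⟨a, ha, b, hb, rfl⟩
    obtain ⟨α, β, rfl⟩ := Submodule.mem_span_pair.1 ha
    obtain ⟨γ, δ, rfl⟩ := Submodule.mem_span_pair.1 hb
    refine Submodule.mem_span_singleton.2 ⟨α * δ - β * γ, ?_⟩
    simp only [map_add, map_smul, LinearMap.add_apply, LinearMap.smul_apply, halt, hneg]
    module
  · rw [Submodule.span_le, Set.singleton_subset_iff]
    exact Submodule.subset_span ⟨x, Submodule.subset_span (by simp), y,
      Submodule.subset_span (by simp), rfl⟩

theorem exists_planeSpan {n : ℕ} (W : RealGrassmannian 2 n) :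
    ∃ x y, ∃ h : LinearIndependent ℝ ![x, y], W = planeSpan x y h := by
  let b := Module.finBasisOfFinrankEq ℝ W.1 W.2
  have hli : LinearIndependent ℝ ![(b 0 : EuclideanSpace ℝ (Fin n)), b 1] := by
    have h1 : ![(b 0 : EuclideanSpace ℝ (Fin n)), b 1] = W.1.subtype ∘ b := by
      ext1 i
      fin_cases i <;> rfl
    rw [h1]
    exact b.linearIndependent.map' W.1.subtype (Submodule.ker_subtype _)
  refine ⟨b 0, b 1, hli, Subtype.ext (Submodule.eq_of_le_of_finrank_eq ?_ ?_).symm⟩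
  · change Submodule.span ℝ (Set.range ![(b 0 : EuclideanSpace ℝ (Fin n)), b 1]) ≤ W.1
    rw [Submodule.span_le]
    rintro _ ⟨i, rfl⟩
    fin_cases i <;> simp
  · rw [W.2, (planeSpan _ _ hli).2]

theorem planeSpan_val {n : ℕ} (x y : EuclideanSpace ℝ (Fin n)) (h : LinearIndependent ℝ ![x, y]) :
    (planeSpan x y h).1 = Submodule.span ℝ {x, y} := by
  simp [planeSpan, RealGrassmannian.ofFrame, Matrix.range_cons, Set.pair_comm]

/-- The map `Gr₂(ℝⁿ) → ℝPᵐ`, `⟨x, y⟩ ↦ [μ x y]`, induced by an alternating bilinear map `μ` which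
does not vanish on linearly independent pairs. The line `[μ x y]` is written without a choice of
basis as the span of all `μ a b` with `a, b` in the plane. -/
def planeToLine {n m : ℕ}
    (μ : EuclideanSpace ℝ (Fin n) →ₗ[ℝ] EuclideanSpace ℝ (Fin n) →ₗ[ℝ]
      EuclideanSpace ℝ (Fin (m + 1)))
    (halt : ∀ x, μ x x = 0) (hne : ∀ x y, LinearIndependent ℝ ![x, y] → μ x y ≠ 0)
    (W : RealGrassmannian 2 n) : RealProjectiveSpace m :=
  ⟨Submodule.span ℝ {z | ∃ a ∈ W.1, ∃ b ∈ W.1, μ a b = z}, by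
    obtain ⟨x, y, h, rfl⟩ := exists_planeSpan W
    rw [planeSpan_val, span_alternating μ halt]
    exact finrank_span_singleton (hne x y h)⟩

theorem planeToLine_planeSpan {n m : ℕ}
    (μ : EuclideanSpace ℝ (Fin n) →ₗ[ℝ] EuclideanSpace ℝ (Fin n) →ₗ[ℝ]
      EuclideanSpace ℝ (Fin (m + 1)))
    (halt : ∀ x, μ x x = 0) (hne : ∀ x y, LinearIndependent ℝ ![x, y] → μ x y ≠ 0)
    (x y : EuclideanSpace ℝ (Fin n)) (h : LinearIndependent ℝ ![x, y]) :
    planeToLine μ halt hne (planeSpan x y h) = RealProjectiveSpace.mk (μ x y) (hne x y h) := by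
  apply Subtype.ext
  change Submodule.span ℝ {z | ∃ a ∈ (planeSpan x y h).1, ∃ b ∈ (planeSpan x y h).1, μ a b = z} =
    Submodule.span ℝ {μ x y}
  rw [planeSpan_val, span_alternating μ halt]

theorem gram_ne_zero {n : ℕ} (x y : EuclideanSpace ℝ (Fin n))
    (h : LinearIndependent ℝ ![x, y]) :
    (∑ i, x i ^ 2) * (∑ i, y i ^ 2) - (∑ i, x i * y i) ^ 2 ≠ 0 := by
  intro h0
  have hx : ∑ i, x i ^ 2 = inner ℝ x x := by
    simp only [PiLp.inner_apply, RCLike.inner_apply, conj_trivial, sq]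
  have hy : ∑ i, y i ^ 2 = inner ℝ y y := by
    simp only [PiLp.inner_apply, RCLike.inner_apply, conj_trivial, sq]
  have hxy : ∑ i, x i * y i = inner ℝ x y := by
    simp [PiLp.inner_apply, mul_comm]
  rw [hx, hy, hxy] at h0
  have h1 : inner ℝ ((inner ℝ y y : ℝ) • x - (inner ℝ x y : ℝ) • y)
      ((inner ℝ y y : ℝ) • x - (inner ℝ x y : ℝ) • y) = (0 : ℝ) := by
    simp only [inner_sub_left, inner_sub_right, real_inner_smul_left, real_inner_smul_right]
    rw [real_inner_comm x y]
    linear_combination (inner ℝ y y : ℝ) * h0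
  have h2 := inner_self_eq_zero.1 h1
  have h3 := LinearIndependent.pair_iff.1 h (inner ℝ y y) (-inner ℝ x y) (by
    rw [neg_smul, ← sub_eq_add_neg]; exact h2)
  have h4 : y = 0 := inner_self_eq_zero.1 h3.1
  exact (LinearIndependent.ne_zero 1 h) (by simpa using h4)

/-! ## Quaternions and the map `ν₄` -/

/-- The quaternion `x₀ + x₁ i + x₂ j + x₃ k`. -/
def toQuaternion (x : EuclideanSpace ℝ (Fin 4)) : ℍ[ℝ] := ⟨x 0, x 1, x 2, x 3⟩

theorem toQuaternion_add (x y : EuclideanSpace ℝ (Fin 4)) :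
    toQuaternion (x + y) = toQuaternion x + toQuaternion y := rfl

theorem toQuaternion_smul (c : ℝ) (x : EuclideanSpace ℝ (Fin 4)) :
    toQuaternion (c • x) = c • toQuaternion x := rfl

theorem toQuaternion_bijective : Function.Bijective toQuaternion :=
  ⟨fun x y h => by
    ext i
    fin_cases i
    exacts [congrArg (·.re) h, congrArg (·.imI) h, congrArg (·.imJ) h, congrArg (·.imK) h],
   fun q => ⟨!₂[q.re, q.imI, q.imJ, q.imK], rfl⟩⟩

/-- `μ(x, y) = (y x̄ - x ȳ) / 2` on the quaternions. -/
def quaternionMu (x y : ℍ[ℝ]) : ℍ[ℝ] := (1 / 2 : ℝ) • (y * star x - x * star y)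

theorem star_quaternionMu (x y : ℍ[ℝ]) : star (quaternionMu x y) = -quaternionMu x y := by
  simp [quaternionMu, ← smul_neg]

/-- The vector of imaginary coordinates, which identifies pure quaternions with `ℝ³`. -/
def quaternionIm (q : ℍ[ℝ]) : EuclideanSpace ℝ (Fin 3) := !₂[q.imI, q.imJ, q.imK]

/-- `μ` as an alternating bilinear map `ℝ⁴ × ℝ⁴ → ℝ³`. -/
def mu4 : EuclideanSpace ℝ (Fin 4) →ₗ[ℝ] EuclideanSpace ℝ (Fin 4) →ₗ[ℝ]
    EuclideanSpace ℝ (Fin 3) :=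
  LinearMap.mk₂ ℝ (fun x y => quaternionIm (quaternionMu (toQuaternion x) (toQuaternion y)))
    (by intro x x' y; ext i; fin_cases i <;>
          simp [quaternionIm, quaternionMu, toQuaternion_add] <;> ring)
    (by intro c x y; ext i; fin_cases i <;>
          simp [quaternionIm, quaternionMu, toQuaternion_smul] <;> ring)
    (by intro x y y'; ext i; fin_cases i <;>
          simp [quaternionIm, quaternionMu, toQuaternion_add] <;> ring)
    (by intro c x y; ext i; fin_cases i <;>
          simp [quaternionIm, quaternionMu, toQuaternion_smul] <;> ring)

theorem mu4_apply (x y : EuclideanSpace ℝ (Fin 4)) :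
    mu4 x y = quaternionIm (quaternionMu (toQuaternion x) (toQuaternion y)) := rfl

theorem mu4_self (x : EuclideanSpace ℝ (Fin 4)) : mu4 x x = 0 := by
  ext i
  fin_cases i <;> simp [mu4_apply, quaternionIm, quaternionMu]

theorem mu4_ne_zero (x y : EuclideanSpace ℝ (Fin 4)) (h : LinearIndependent ℝ ![x, y]) :
    mu4 x y ≠ 0 := by
  intro h0
  apply gram_ne_zero x y h
  have h1 : mu4 x y 0 ^ 2 + mu4 x y 1 ^ 2 + mu4 x y 2 ^ 2 = 0 := by simp [h0]
  rw [← h1]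
  have e0 : ∀ z, z 0 = (toQuaternion z).re := fun _ => rfl
  have e1 : ∀ z, z 1 = (toQuaternion z).imI := fun _ => rfl
  have e2 : ∀ z, z 2 = (toQuaternion z).imJ := fun _ => rfl
  have e3 : ∀ z, z 3 = (toQuaternion z).imK := fun _ => rfl
  rw [Fin.sum_univ_four, Fin.sum_univ_four, Fin.sum_univ_four, e0 x, e1 x, e2 x, e3 x,
    e0 y, e1 y, e2 y, e3 y]
  simp [mu4_apply, quaternionIm, quaternionMu]
  ring

/-- `ν₄ : Gr₂(ℝ⁴) → ℝP²`, `⟨x, y⟩ ↦ [(y x̄ - x ȳ) / 2]`, with quaternionic multiplication. -/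
def nu4 : RealGrassmannian 2 4 → RealProjectiveSpace 2 := planeToLine mu4 mu4_self mu4_ne_zero

theorem nu4_planeSpan (x y : EuclideanSpace ℝ (Fin 4)) (h : LinearIndependent ℝ ![x, y]) :
    nu4 (planeSpan x y h) = RealProjectiveSpace.mk
      (quaternionIm (quaternionMu (toQuaternion x) (toQuaternion y))) (mu4_ne_zero x y h) :=
  planeToLine_planeSpan _ _ _ _ _ _

/-! ## Octonions and the map `ν₈` -/

/-- The standard basis `e₀, …, e₇` of the octonions `𝕆 = ℝ⁸`. -/
def octE (i : Fin 8) : EuclideanSpace ℝ (Fin 8) := EuclideanSpace.single i 1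

/-- The multiplication table of the octonions: the entry `(i, j)` is `eᵢ eⱼ`. -/
def octTable : Matrix (Fin 8) (Fin 8) (EuclideanSpace ℝ (Fin 8)) :=
  !![octE 0,  octE 1,  octE 2,  octE 3,  octE 4,  octE 5,  octE 6,  octE 7;
     octE 1, -octE 0,  octE 3, -octE 2,  octE 5, -octE 4, -octE 7,  octE 6;
     octE 2, -octE 3, -octE 0,  octE 1,  octE 6,  octE 7, -octE 4, -octE 5;
     octE 3,  octE 2, -octE 1, -octE 0,  octE 7, -octE 6,  octE 5, -octE 4;
     octE 4, -octE 5, -octE 6, -octE 7, -octE 0,  octE 1,  octE 2,  octE 3;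
     octE 5,  octE 4, -octE 7,  octE 6, -octE 1, -octE 0, -octE 3,  octE 2;
     octE 6,  octE 7,  octE 4, -octE 5, -octE 2,  octE 3, -octE 0, -octE 1;
     octE 7, -octE 6,  octE 5,  octE 4, -octE 3, -octE 2,  octE 1, -octE 0]

/-- Octonion multiplication: the bilinear extension of the table. -/
def octMul (x y : EuclideanSpace ℝ (Fin 8)) : EuclideanSpace ℝ (Fin 8) :=
  ∑ i, ∑ j, (x i * y j) • octTable i j

/-- Octonion conjugation `x₀ e₀ + ∑ xᵢ eᵢ ↦ x₀ e₀ - ∑ xᵢ eᵢ`. -/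
def octConj (x : EuclideanSpace ℝ (Fin 8)) : EuclideanSpace ℝ (Fin 8) :=
  x 0 • octE 0 - ∑ i : Fin 7, x i.succ • octE i.succ

/-- `μ(x, y) = (y x̄ - x ȳ) / 2` on the octonions. -/
def octMu (x y : EuclideanSpace ℝ (Fin 8)) : EuclideanSpace ℝ (Fin 8) :=
  (1 / 2 : ℝ) • (octMul y (octConj x) - octMul x (octConj y))

/-- The vector of imaginary coordinates, which identifies pure octonions with `ℝ⁷`. -/
def octIm (x : EuclideanSpace ℝ (Fin 8)) : EuclideanSpace ℝ (Fin 7) :=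
  WithLp.toLp 2 fun i => x i.succ

theorem octConj_apply (x : EuclideanSpace ℝ (Fin 8)) (i : Fin 8) :
    octConj x i = if i = 0 then x i else -x i := by
  fin_cases i <;> simp [octConj, octE, Fin.sum_univ_seven, Fin.ext_iff]

theorem octMul_add_left (x x' y : EuclideanSpace ℝ (Fin 8)) :
    octMul (x + x') y = octMul x y + octMul x' y := by
  simp [octMul, add_mul, add_smul, Finset.sum_add_distrib]

theorem octMul_smul_left (c : ℝ) (x y : EuclideanSpace ℝ (Fin 8)) :
    octMul (c • x) y = c • octMul x y := by
  simp [octMul, mul_assoc, mul_smul, Finset.smul_sum]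

theorem octMul_add_right (x y y' : EuclideanSpace ℝ (Fin 8)) :
    octMul x (y + y') = octMul x y + octMul x y' := by
  simp [octMul, mul_add, add_smul, Finset.sum_add_distrib]

theorem octMul_smul_right (c : ℝ) (x y : EuclideanSpace ℝ (Fin 8)) :
    octMul x (c • y) = c • octMul x y := by
  simp [octMul, mul_left_comm _ c, mul_smul, Finset.smul_sum]

theorem octConj_add (x y : EuclideanSpace ℝ (Fin 8)) :
    octConj (x + y) = octConj x + octConj y := by
  ext i
  simp only [octConj_apply, PiLp.add_apply]
  split_ifs <;> ring

theorem octConj_smul (c : ℝ) (x : EuclideanSpace ℝ (Fin 8)) :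
    octConj (c • x) = c • octConj x := by
  ext i
  simp only [octConj_apply, PiLp.smul_apply, smul_eq_mul]
  split_ifs <;> ring

/-- `μ` as an alternating bilinear map `ℝ⁸ × ℝ⁸ → ℝ⁷`. -/
def mu8 : EuclideanSpace ℝ (Fin 8) →ₗ[ℝ] EuclideanSpace ℝ (Fin 8) →ₗ[ℝ]
    EuclideanSpace ℝ (Fin 7) :=
  LinearMap.mk₂ ℝ (fun x y => octIm (octMu x y))
    (by intro x x' y; ext i; simp [octIm, octMu, octMul_add_left, octMul_add_right, octConj_add]; ring)
    (by intro c x y; ext i; simp [octIm, octMu, octMul_smul_left, octMul_smul_right, octConj_smul]; ring)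
    (by intro x y y'; ext i; simp [octIm, octMu, octMul_add_left, octMul_add_right, octConj_add]; ring)
    (by intro c x y; ext i; simp [octIm, octMu, octMul_smul_left, octMul_smul_right, octConj_smul]; ring)

theorem mu8_apply (x y : EuclideanSpace ℝ (Fin 8)) : mu8 x y = octIm (octMu x y) := rfl

theorem mu8_self (x : EuclideanSpace ℝ (Fin 8)) : mu8 x x = 0 := by
  ext i
  simp [mu8_apply, octIm, octMu]

theorem octE_apply (i k : Fin 8) : octE i k = if k = i then 1 else 0 := by
  simp [octE]

set_option maxHeartbeats 2000000 in
theorem octMul_eq (x y : EuclideanSpace ℝ (Fin 8)) :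
    octMul x y = !₂[
      x 0 * y 0 - x 1 * y 1 - x 2 * y 2 - x 3 * y 3 - x 4 * y 4 - x 5 * y 5 - x 6 * y 6 - x 7 * y 7,
      x 0 * y 1 + x 1 * y 0 + x 2 * y 3 - x 3 * y 2 + x 4 * y 5 - x 5 * y 4 - x 6 * y 7 + x 7 * y 6,
      x 0 * y 2 + x 2 * y 0 - x 1 * y 3 + x 3 * y 1 + x 4 * y 6 - x 6 * y 4 + x 5 * y 7 - x 7 * y 5,
      x 0 * y 3 + x 3 * y 0 + x 1 * y 2 - x 2 * y 1 + x 4 * y 7 - x 7 * y 4 - x 5 * y 6 + x 6 * y 5,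
      x 0 * y 4 + x 4 * y 0 - x 1 * y 5 + x 5 * y 1 - x 2 * y 6 + x 6 * y 2 - x 3 * y 7 + x 7 * y 3,
      x 0 * y 5 + x 5 * y 0 + x 1 * y 4 - x 4 * y 1 - x 2 * y 7 + x 7 * y 2 + x 3 * y 6 - x 6 * y 3,
      x 0 * y 6 + x 6 * y 0 + x 1 * y 7 - x 7 * y 1 + x 2 * y 4 - x 4 * y 2 - x 3 * y 5 + x 5 * y 3,
      x 0 * y 7 + x 7 * y 0 - x 1 * y 6 + x 6 * y 1 + x 2 * y 5 - x 5 * y 2 + x 3 * y 4 - x 4 * y 3] := by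
  have h : octMul x y = ∑ i, x i • (∑ j, y j • octTable i j) := by
    simp [octMul, Finset.smul_sum, mul_smul]
  rw [h]
  have r0 : ∑ j, y j • octTable 0 j = !₂[y 0, y 1, y 2, y 3, y 4, y 5, y 6, y 7] := by
    ext k
    fin_cases k <;> simp [octTable, octE_apply, Fin.sum_univ_eight, Fin.ext_iff]
  have r1 : ∑ j, y j • octTable 1 j = !₂[-y 1, y 0, -y 3, y 2, -y 5, y 4, y 7, -y 6] := by
    ext k
    fin_cases k <;> simp [octTable, octE_apply, Fin.sum_univ_eight, Fin.ext_iff]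
  have r2 : ∑ j, y j • octTable 2 j = !₂[-y 2, y 3, y 0, -y 1, -y 6, -y 7, y 4, y 5] := by
    ext k
    fin_cases k <;> simp [octTable, octE_apply, Fin.sum_univ_eight, Fin.ext_iff]
  have r3 : ∑ j, y j • octTable 3 j = !₂[-y 3, -y 2, y 1, y 0, -y 7, y 6, -y 5, y 4] := by
    ext k
    fin_cases k <;> simp [octTable, octE_apply, Fin.sum_univ_eight, Fin.ext_iff]
  have r4 : ∑ j, y j • octTable 4 j = !₂[-y 4, y 5, y 6, y 7, y 0, -y 1, -y 2, -y 3] := by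
    ext k
    fin_cases k <;> simp [octTable, octE_apply, Fin.sum_univ_eight, Fin.ext_iff]
  have r5 : ∑ j, y j • octTable 5 j = !₂[-y 5, -y 4, y 7, -y 6, y 1, y 0, y 3, -y 2] := by
    ext k
    fin_cases k <;> simp [octTable, octE_apply, Fin.sum_univ_eight, Fin.ext_iff]
  have r6 : ∑ j, y j • octTable 6 j = !₂[-y 6, -y 7, -y 4, y 5, y 2, -y 3, y 0, y 1] := by
    ext k
    fin_cases k <;> simp [octTable, octE_apply, Fin.sum_univ_eight, Fin.ext_iff]
  have r7 : ∑ j, y j • octTable 7 j = !₂[-y 7, y 6, -y 5, -y 4, y 3, y 2, -y 1, y 0] := by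
    ext k
    fin_cases k <;> simp [octTable, octE_apply, Fin.sum_univ_eight, Fin.ext_iff]
  rw [Fin.sum_univ_eight, r0, r1, r2, r3, r4, r5, r6, r7]
  ext k
  fin_cases k <;> simp <;> ring

/-- The coordinates of `μ(x, y)`; in particular `μ(x, y)` is a pure octonion. -/
theorem octMu_eq (x y : EuclideanSpace ℝ (Fin 8)) :
    let p : Fin 8 → Fin 8 → ℝ := fun i j => x i * y j - x j * y i
    octMu x y = !₂[0,
      p 0 1 + p 2 3 + p 4 5 - p 6 7, p 0 2 - p 1 3 + p 4 6 + p 5 7,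
      p 0 3 + p 1 2 + p 4 7 - p 5 6, p 0 4 - p 1 5 - p 2 6 - p 3 7,
      p 0 5 + p 1 4 - p 2 7 + p 3 6, p 0 6 + p 1 7 + p 2 4 - p 3 5,
      p 0 7 - p 1 6 + p 2 5 + p 3 4] := by
  intro p
  rw [octMu, octMul_eq, octMul_eq]
  ext i
  fin_cases i <;> simp [p, octConj_apply] <;> ring

theorem mu8_ne_zero (x y : EuclideanSpace ℝ (Fin 8)) (h : LinearIndependent ℝ ![x, y]) :
    mu8 x y ≠ 0 := by
  intro h0
  apply gram_ne_zero x y h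
  have h1 : ∑ i, mu8 x y i ^ 2 = 0 := by simp [h0]
  rw [← h1]
  simp only [mu8_apply, octIm, octMu_eq, Fin.sum_univ_seven, Fin.sum_univ_eight]
  simp
  ring

/-- `ν₈ : Gr₂(ℝ⁸) → ℝP⁶`, `⟨x, y⟩ ↦ [(y x̄ - x ȳ) / 2]`, with octonionic multiplication. -/
def nu8 : RealGrassmannian 2 8 → RealProjectiveSpace 6 := planeToLine mu8 mu8_self mu8_ne_zero

theorem nu8_planeSpan (x y : EuclideanSpace ℝ (Fin 8)) (h : LinearIndependent ℝ ![x, y]) :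
    nu8 (planeSpan x y h) = RealProjectiveSpace.mk (octIm (octMu x y)) (mu8_ne_zero x y h) :=
  planeToLine_planeSpan _ _ _ _ _ _

end

/-! Multiplication in the two algebras enters only through one property: $\mu(x,y)=\frac12(y\bar
x-x\bar y)$ is an alternating bilinear map $\mathbb R^n\times\mathbb R^n\to\mathbb R^{m+1}$ with
$n=m+2$ that does not vanish on independent pairs. For $\mathbb H$ and $\mathbb O$ the non-vanishing
comes from $|\mu(x,y)|^2=|x|^2|y|^2-\langle x,y\rangle^2$.

For any such $\mu$ the map $\nu:\langle x,y\rangle\mapsto[\mu(x,y)]$ has a smooth section through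
each plane. Fix $\langle x,y\rangle$. The kernel of $\mu(\cdot,y)$ is the line $\mathbb Ry$, so its
rank is $n-1=m+1$ and it has a linear right inverse $L$. Then $\sigma[u]=\langle Lu,y\rangle$
satisfies $\nu\circ\sigma=\mathrm{id}$. Moreover $x-L\mu(x,y)$ lies in the kernel $\mathbb Ry$, so
$\sigma$ sends $[\mu(x,y)]$ back to $\langle x,y\rangle$. The chain rule makes $d\sigma$ a right
inverse of $d\nu$ at $\langle x,y\rangle$ (`exists_smooth_section_planeToLine`,
`isSmoothSubmersion_planeToLine`).

Smoothness of $\nu$ and $\sigma$ is checked on frames: points of the Grassmannian locally have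
smoothly varying bases (`exists_smooth_span`), and a subspace spanned by a smoothly varying frame
varies smoothly (`contMDiffAt_of_span`). -/

namespace RealGrassmannian

/-! ### Smooth frames on Grassmannians -/

variable {k n : ℕ}

theorem chart_mem_maximalAtlas (φ : Splitting k n) :
    chart φ ∈ IsManifold.maximalAtlas 𝓘(ℝ, Model k n) ∞ (RealGrassmannian k n) :=
  IsManifold.subset_maximalAtlas ⟨φ, rfl⟩

/-- This is the inverse of a chart. Every linear map has a graph, so the chart's target is the whole
model space and smoothness is global. -/
theorem contMDiff_ofGraph (φ : Splitting k n) :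
    ContMDiff 𝓘(ℝ, Model k n) 𝓘(ℝ, Model k n) ∞ (ofGraph φ) := by
  have h := contMDiffOn_symm_of_mem_maximalAtlas (chart_mem_maximalAtlas φ)
  have ht : (chart φ).target = Set.univ := by simp [chart]
  rw [ht, contMDiffOn_univ] at h
  exact h

theorem contDiff_colMap {V : Type} [NormedAddCommGroup V] [NormedSpace ℝ V] :
    ContDiff ℝ ∞ (colMap : (Fin k → V) → EuclideanSpace ℝ (Fin k) →L[ℝ] V) := by
  unfold colMap
  refine ContDiff.sum fun i _ => ?_
  exact (ContinuousLinearMap.smulRightL ℝ (EuclideanSpace ℝ (Fin k)) V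
    (EuclideanSpace.proj i)).contDiff.comp (contDiff_apply ℝ V i)

/-- A map into the Grassmannian is smooth at `p` if near `p` it is the span of a smooth tuple of
vectors. -/
theorem contMDiffAt_of_span {E : Type*} [NormedAddCommGroup E] [NormedSpace ℝ E] {M : Type*}
    [TopologicalSpace M] [ChartedSpace E M] {f : M → RealGrassmannian k n}
    {v : M → Fin k → EuclideanSpace ℝ (Fin n)} {p : M}
    (hv : ContMDiffAt 𝓘(ℝ, E) 𝓘(ℝ, Fin k → EuclideanSpace ℝ (Fin n)) ∞ v p)
    (hf : ∀ᶠ q in 𝓝 p, (f q).1 = Submodule.span ℝ (Set.range (v q))) :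
    ContMDiffAt 𝓘(ℝ, E) 𝓘(ℝ, Model k n) ∞ f p := by
  obtain ⟨φ, hφ⟩ := exists_mem_chart_source (f p)
  -- In the splitting, a frame is a block column with blocks `A` and `B`. Where `A` is invertible,
  -- the frame spans the graph of $BA^{-1}$.
  let A : (Fin k → EuclideanSpace ℝ (Fin n)) →
      (EuclideanSpace ℝ (Fin k) →L[ℝ] EuclideanSpace ℝ (Fin k)) := fun w =>
    (ContinuousLinearMap.fst ℝ _ _).comp (φ.toContinuousLinearMap.comp (colMap w))
  let B : (Fin k → EuclideanSpace ℝ (Fin n)) → Model k n := fun w =>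
    (ContinuousLinearMap.snd ℝ _ _).comp (φ.toContinuousLinearMap.comp (colMap w))
  have hA : ContDiff ℝ ∞ A := contDiff_const.clm_comp (contDiff_const.clm_comp contDiff_colMap)
  have hB : ContDiff ℝ ∞ B := contDiff_const.clm_comp (contDiff_const.clm_comp contDiff_colMap)
  have hu : IsUnit (A (v p)) :=
    ((eq_ofGraph_iff φ (f p) (colMap (v p)) ((range_colMap _).trans hf.self_of_nhds.symm) _).1
      ((chart φ).left_inv hφ)).1
  -- `Ring.inverse` takes the value zero off the units, so smoothness is claimed only at `v p`,
  -- where `A` is a unit.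
  have hG : ContDiffAt ℝ ∞ (fun w => (B w).comp (Ring.inverse (A w))) (v p) := by
    obtain ⟨u, hu'⟩ := hu
    have h := contDiffAt_ringInverse ℝ (n := ∞) u
    rw [hu'] at h
    exact hB.contDiffAt.clm_comp (ContDiffAt.comp (f := A) (v p) h hA.contDiffAt)
  have hcomp : ContMDiffAt 𝓘(ℝ, E) 𝓘(ℝ, Model k n) ∞
      (fun q => ofGraph φ ((B (v q)).comp (Ring.inverse (A (v q))))) p :=
    (contMDiff_ofGraph φ).contMDiffAt.comp p (hG.contMDiffAt.comp p hv)
  have hunit : ∀ᶠ q in 𝓝 p, IsUnit (A (v q)) :=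
    -- Invertibility is an open condition, so it persists near `p`, and there the formula $BA^{-1}$
    -- describes `f`.
    (hA.continuous.continuousAt.comp hv.continuousAt).eventually (Units.isOpen.mem_nhds hu)
  refine hcomp.congr_of_eventuallyEq ?_
  filter_upwards [hf, hunit] with q hq hq'
  exact ((eq_ofGraph_iff φ (f q) (colMap (v q)) ((range_colMap _).trans hq.symm) _).2
    ⟨hq', rfl⟩).symm

/-- Near every point of the Grassmannian there is a smooth frame of the tautological bundle. -/
theorem exists_smooth_span (W : RealGrassmannian k n) :
    ∃ v : RealGrassmannian k n → Fin k → EuclideanSpace ℝ (Fin n),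
      ContMDiffAt 𝓘(ℝ, Model k n) 𝓘(ℝ, Fin k → EuclideanSpace ℝ (Fin n)) ∞ v W ∧
      ∀ᶠ V in 𝓝 W, V.1 = Submodule.span ℝ (Set.range (v V)) := by
  obtain ⟨φ, hφ⟩ := exists_mem_chart_source W
  let g : Model k n → Fin k → EuclideanSpace ℝ (Fin n) := fun T i =>
    φ.symm (EuclideanSpace.single i 1, T (EuclideanSpace.single i 1))
  have hg : ContDiff ℝ ∞ g := by
    refine contDiff_pi.2 fun i => ?_
    exact φ.symm.contDiff.comp (contDiff_const.prodMk
      (contDiff_id.clm_apply contDiff_const))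
  have hspan : ∀ T, (ofGraph φ T).1 = Submodule.span ℝ (Set.range (g T)) := by
    intro T
    apply le_antisymm
    · intro w hw
      rw [mem_ofGraph] at hw
      rw [Submodule.mem_span_range_iff_exists_fun]
      -- A point of the graph is determined by its first component. Its coordinates there serve as
      -- coefficients, and the second component then agrees by linearity of `T`.
      refine ⟨fun i => (φ w).1 i, ?_⟩
      have hsum : ∑ i, (φ w).1 i • (EuclideanSpace.single i (1 : ℝ) :
          EuclideanSpace ℝ (Fin k)) = (φ w).1 := by
        simpa using (EuclideanSpace.basisFun (Fin k) ℝ).sum_repr (φ w).1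
      apply φ.injective
      simp only [g, map_sum, map_smul, ContinuousLinearEquiv.apply_symm_apply]
      apply Prod.ext
      · simpa [Prod.fst_sum] using hsum
      · rw [hw]
        conv_rhs => rw [← hsum]
        simp [Prod.snd_sum]
    · rw [Submodule.span_le]
      rintro _ ⟨i, rfl⟩
      exact mem_ofGraph.2 (by simp [g])
  -- Values outside the chart's source are irrelevant, since both claims are local at `W`.
  refine ⟨fun V => g (chart φ V), ?_, ?_⟩
  · exact hg.contMDiff.contMDiffAt.comp W
      (contMDiffAt_of_mem_maximalAtlas (chart_mem_maximalAtlas φ) hφ)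
  · filter_upwards [(chart φ).open_source.mem_nhds hφ] with V hV
    rw [← hspan]
    exact (congrArg Subtype.val ((chart φ).left_inv hV)).symm

end RealGrassmannian

open RealGrassmannian

theorem RealProjectiveSpace.val_mk {m : ℕ} (u : EuclideanSpace ℝ (Fin (m + 1))) (hu : u ≠ 0) :
    (mk u hu).1 = Submodule.span ℝ {u} := rfl

/-! ### Smoothness of the map from planes to lines, and sections through every plane -/

section PlaneToLine

variable {n m : ℕ}
  (μ : EuclideanSpace ℝ (Fin n) →ₗ[ℝ] EuclideanSpace ℝ (Fin n) →ₗ[ℝ]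
    EuclideanSpace ℝ (Fin (m + 1)))
  (halt : ∀ x, μ x x = 0) (hne : ∀ x y, LinearIndependent ℝ ![x, y] → μ x y ≠ 0)

/-- A local smooth frame $(v_0,v_1)$ of the planes gives the local smooth frame $\mu(v_0,v_1)$ of
the image lines. -/
theorem contMDiff_planeToLine :
    ContMDiff 𝓘(ℝ, Model 2 n) 𝓘(ℝ, Model 1 (m + 1)) ∞ (planeToLine μ halt hne) := by
  intro W
  obtain ⟨v, hv, hspan⟩ := exists_smooth_span W
  -- In finite dimensions $\mu$ becomes a continuous linear map with values in continuous linear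
  -- maps, so $\mu(v_0,v_1)$ is smooth as an evaluation.
  let μc := (LinearMap.toContinuousLinearMap.toLinearMap ∘ₗ μ).toContinuousLinearMap
  have hμ : ContDiff ℝ ∞ (fun w : Fin 2 → EuclideanSpace ℝ (Fin n) =>
      (fun _ => μ (w 0) (w 1) : Fin 1 → EuclideanSpace ℝ (Fin (m + 1)))) :=
    contDiff_pi.2 fun _ => (μc.contDiff.comp (contDiff_apply ℝ _ 0)).clm_apply
      (contDiff_apply ℝ _ 1)
  refine contMDiffAt_of_span (hμ.contMDiff.contMDiffAt.comp W hv) ?_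
  filter_upwards [hspan] with V hV
  have hV' : V.1 = Submodule.span ℝ {v V 0, v V 1} := by
    rw [hV]
    congr 1
    ext z
    simp [Fin.exists_fin_two, eq_comm]
  change Submodule.span ℝ {z | ∃ a ∈ V.1, ∃ b ∈ V.1, μ a b = z} = _
  rw [hV', span_alternating μ halt]
  simp

/-- The plane spanned by the line `s` of `ℝᵐ⁺¹`, transported by `L`, together with `y`. -/
def lineToPlane (L : EuclideanSpace ℝ (Fin (m + 1)) →ₗ[ℝ] EuclideanSpace ℝ (Fin n))
    (y : EuclideanSpace ℝ (Fin n)) (hL : ∀ u, u ≠ 0 → LinearIndependent ℝ ![L u, y])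
    (s : RealProjectiveSpace m) : RealGrassmannian 2 n :=
  ⟨s.1.map L ⊔ Submodule.span ℝ {y}, by
    obtain ⟨u, hu, rfl⟩ := s.exists_mk
    rw [RealProjectiveSpace.val_mk, Submodule.map_span, Set.image_singleton,
      ← Submodule.span_union, Set.singleton_union, ← planeSpan_val _ _ (hL u hu)]
    exact (planeSpan _ _ (hL u hu)).2⟩

variable (L : EuclideanSpace ℝ (Fin (m + 1)) →ₗ[ℝ] EuclideanSpace ℝ (Fin n))
    (y : EuclideanSpace ℝ (Fin n)) (hL : ∀ u, u ≠ 0 → LinearIndependent ℝ ![L u, y])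

theorem lineToPlane_mk (u : EuclideanSpace ℝ (Fin (m + 1))) (hu : u ≠ 0) :
    lineToPlane L y hL (RealProjectiveSpace.mk u hu) = planeSpan (L u) y (hL u hu) := by
  apply Subtype.ext
  change Submodule.map L (Submodule.span ℝ {u}) ⊔ Submodule.span ℝ {y} = _
  rw [Submodule.map_span, Set.image_singleton, ← Submodule.span_union, Set.singleton_union,
    planeSpan_val]

/-- A local smooth generator $v_0$ of the lines gives the local smooth frame $(Lv_0,y)$ of the
planes. -/
theorem contMDiff_lineToPlane :
    ContMDiff 𝓘(ℝ, Model 1 (m + 1)) 𝓘(ℝ, Model 2 n) ∞ (lineToPlane L y hL) := by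
  intro s
  obtain ⟨v, hv, hspan⟩ := exists_smooth_span s
  have h : ContDiff ℝ ∞ (fun w : Fin 1 → EuclideanSpace ℝ (Fin (m + 1)) => ![L (w 0), y]) := by
    refine contDiff_pi.2 fun i => ?_
    fin_cases i
    · exact L.toContinuousLinearMap.contDiff.comp (contDiff_apply ℝ _ 0)
    · exact contDiff_const
  refine contMDiffAt_of_span (h.contMDiff.contMDiffAt.comp s hv) ?_
  filter_upwards [hspan] with t ht
  change t.1.map L ⊔ Submodule.span ℝ {y} = _
  rw [ht, Submodule.map_span, ← Submodule.span_union]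
  congr 1
  ext z
  simp [eq_comm]

/-- The kernel of `μ · y` is the line spanned by `y`, so `μ · y` is onto by a dimension count. -/
theorem surjective_flip_of_ne_zero
    (hne : ∀ x y, LinearIndependent ℝ ![x, y] → μ x y ≠ 0) (hn : n = m + 2)
    (hy : y ≠ 0) : Function.Surjective (μ.flip y) := by
  have hker : LinearMap.ker (μ.flip y) ≤ Submodule.span ℝ {y} := by
    intro x hx
    by_contra hxy
    refine hne x y ?_ hx
    rw [LinearIndependent.pair_symm_iff, LinearIndependent.pair_iff' hy]
    intro a ha
    exact hxy (Submodule.mem_span_singleton.2 ⟨a, ha⟩)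
  -- The nullity is at most $1$ in a source of dimension $m+2$, so the rank is at least $m+1$, the
  -- dimension of the target.
  have h1 := Submodule.finrank_mono hker
  rw [finrank_span_singleton hy] at h1
  have h2 := LinearMap.finrank_range_add_finrank_ker (μ.flip y)
  rw [finrank_euclideanSpace, Fintype.card_fin] at h2
  have h3 := Submodule.finrank_le (LinearMap.range (μ.flip y))
  rw [← LinearMap.range_eq_top]
  apply Submodule.eq_top_of_finrank_eq
  rw [finrank_euclideanSpace, Fintype.card_fin] at h3 ⊢
  omega

/-- If `n = m + 2`, the plane `⟨x, y⟩` lies in the image of a smooth section of `planeToLine μ`. -/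
theorem exists_smooth_section_planeToLine (hn : n = m + 2) (W : RealGrassmannian 2 n) :
    ∃ σ : RealProjectiveSpace m → RealGrassmannian 2 n,
      ContMDiff 𝓘(ℝ, Model 1 (m + 1)) 𝓘(ℝ, Model 2 n) ∞ σ ∧
      Function.LeftInverse (planeToLine μ halt hne) σ ∧ σ (planeToLine μ halt hne W) = W := by
  obtain ⟨x, y, h, rfl⟩ := exists_planeSpan W
  have hy : y ≠ 0 := by simpa using h.ne_zero 1
  obtain ⟨L, hL⟩ := (μ.flip y).exists_rightInverse_of_surjective
    (LinearMap.range_eq_top.2 (surjective_flip_of_ne_zero μ y hne hn hy))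
  have hLu : ∀ u, μ (L u) y = u := fun u => LinearMap.congr_fun hL u
  -- If $Lu=ay$, then $u=\mu(Lu,y)=a\,\mu(y,y)=0$.
  have hind : ∀ u, u ≠ 0 → LinearIndependent ℝ ![L u, y] := by
    intro u hu
    rw [LinearIndependent.pair_symm_iff, LinearIndependent.pair_iff' hy]
    intro a ha
    apply hu
    rw [← hLu u, ← ha, map_smul, LinearMap.smul_apply, halt, smul_zero]
  refine ⟨lineToPlane L y hind, contMDiff_lineToPlane L y hind, fun s => ?_, ?_⟩
  · obtain ⟨u, hu, rfl⟩ := s.exists_mk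
    rw [lineToPlane_mk, planeToLine_planeSpan]
    simp only [hLu]
  · rw [planeToLine_planeSpan, lineToPlane_mk]
    -- The difference is killed by $\mu(\cdot,y)$, hence is a multiple of $y$. Thus $L\mu(x,y)$ and
    -- $y$ span the original plane.
    have hx : x - L (μ x y) ∈ Submodule.span ℝ {y} := by
      by_contra hxy
      refine hne (x - L (μ x y)) y ?_ (by simp [hLu])
      rw [LinearIndependent.pair_symm_iff, LinearIndependent.pair_iff' hy]
      intro a ha
      exact hxy (Submodule.mem_span_singleton.2 ⟨a, ha⟩)
    obtain ⟨a, ha⟩ := Submodule.mem_span_singleton.1 hx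
    have hLx : L (μ x y) = x - a • y := by rw [ha]; abel
    apply Subtype.ext
    -- Both sides have dimension two, so one inclusion suffices.
    apply Submodule.eq_of_le_of_finrank_eq
    · rw [planeSpan_val, planeSpan_val, Submodule.span_le, hLx]
      rintro _ (rfl | rfl)
      · exact sub_mem (Submodule.subset_span (by simp))
          (Submodule.smul_mem _ _ (Submodule.subset_span (by simp)))
      · exact Submodule.subset_span (by simp)
    · rw [(planeSpan _ _ _).2, (planeSpan _ _ _).2]

/-- Differentiating $\nu\circ\sigma=\mathrm{id}$ at $\nu(W)$ for a section with $\sigma(\nu(W))=W$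
gives $d\nu_W\circ d\sigma=\mathrm{id}$, so $d\nu_W$ is onto. -/
theorem isSmoothSubmersion_planeToLine (hn : n = m + 2) :
    IsSmoothSubmersion (Model 2 n) (Model 1 (m + 1)) (planeToLine μ halt hne) := by
  refine ⟨contMDiff_planeToLine μ halt hne, fun W => ?_⟩
  obtain ⟨σ, hσ, hleft, hW⟩ := exists_smooth_section_planeToLine μ halt hne hn W
  have hν : MDifferentiableAt 𝓘(ℝ, Model 2 n) 𝓘(ℝ, Model 1 (m + 1)) (planeToLine μ halt hne)
      (σ (planeToLine μ halt hne W)) :=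
    (contMDiff_planeToLine μ halt hne).mdifferentiable (by simp) _
  have hc := mfderiv_comp (planeToLine μ halt hne W) hν (hσ.mdifferentiable (by simp) _)
  -- The chain rule places the differential of $\nu$ at $\sigma(\nu(W))$; `hW` moves it to the given
  -- plane.
  rw [hleft.comp_eq_id, mfderiv_id, hW] at hc
  intro w
  exact ⟨mfderiv 𝓘(ℝ, Model 1 (m + 1)) 𝓘(ℝ, Model 2 n) σ (planeToLine μ halt hne W) w,
    (DFunLike.congr_fun hc w).symm⟩

end PlaneToLine

/-! ### The quaternionic and octonionic cases -/

theorem theorem1p3 :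
    IsSmoothSubmersion (RealGrassmannian.Model 2 4) (RealGrassmannian.Model 1 3) nu4 ∧
    IsSmoothSubmersion (RealGrassmannian.Model 2 8) (RealGrassmannian.Model 1 7) nu8 :=
  -- The dimension condition $n=m+2$ reads $4=2+2$ for $\mathbb H$ and $8=6+2$ for $\mathbb O$.
  ⟨isSmoothSubmersion_planeToLine mu4 mu4_self mu4_ne_zero rfl,
    isSmoothSubmersion_planeToLine mu8 mu8_self mu8_ne_zero rfl⟩
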